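/- Let $B\mathbb{Z}/2\mathbb{Z} = [\operatorname{Spec}\mathbb{Q}/(\mathbb{Z}/2\mathbb{Z})]$ be the classifying stack over $\mathbb{Q}$ of the constant group $\mathbb{Z}/2\mathbb{Z}$, and let $[\pi] \in H^1(B\mathbb{Z}/2\mathbb{Z}, \mathbb{Z}/2\mathbb{Z})$ be the class of the universal torsor $\pi : \operatorname{Spec}\mathbb{Q} \to B\mathbb{Z}/2\mathbb{Z}$. Let $(-1,[\pi]) \in \operatorname{Br}(B\mathbb{Z}/2\mathbb{Z}) = H^2(B\mathbb{Z}/2\mathbb{Z}, \mathbb{G}_m)$ be the image of the cup product $-1 \cup [\pi] \in H^2(B\mathbb{Z}/2\mathbb{Z}, \mu_2)$, where $-1 \in H^1(B\mathbb{Z}/2\mathbb{Z}, \mu_2)$ is the Kummer class of $-1 \in \mathbb{Q}^\times$ and the cup product is taken with respect to the pairing $\mathbb{Z}/2\mathbb{Z} \times \mu_2 \to \mu_2$, $(n,\zeta) \mapsto \zeta^n$. Let $K/\mathbb{Q}$ be a quadratic field extension with absolute discriminant $\Delta_{K/\mathbb{Q}} \in \mathbb{Z}$. Then $\Delta_{K/\mathbb{Q}}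 = a^2 + b^2$ for some integers $a, b$ if and only if the specialisation of $(-1,[\pi])$ at the rational point of $B\mathbb{Z}/2\mathbb{Z}$ given by the $\mathbb{Z}/2\mathbb{Z}$-torsor $\operatorname{Spec} K \to \operatorname{Spec}\mathbb{Q}$ is $0$ in $\operatorname{Br}\mathbb{Q} = H^2(\mathbb{Q}, \mathbb{G}_m)$. -/

import Mathlib

/-! ### Cohomology of a topological group with discrete coefficients

The complex of continuous (that is, locally constant) inhomogeneous cochains, in the degrees that
are needed, its functoriality and its cup product. -/

namespace ContCohomology

universe u v v' v'' w

/-- A discrete `Γ`-module: an abelian group with an action of `Γ` by automorphisms that is continuous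
for the discrete topology, that is, every orbit map is locally constant. -/
structure DiscreteModule (Γ : Type u) [Group Γ] [TopologicalSpace Γ] where
  carrier : Type v
  [addCommGroup : AddCommGroup carrier]
  action : Γ →* AddMonoid.End carrier
  isLocallyConstant (m : carrier) : IsLocallyConstant fun s => action s m

attribute [instance] DiscreteModule.addCommGroup

variable {Γ : Type u} [Group Γ] [TopologicalSpace Γ]

/-- An abelian group with the trivial action. -/
abbrev DiscreteModule.trivial (Γ : Type u) [Group Γ] [TopologicalSpace Γ] (M : Type v)
    [AddCommGroup M] : DiscreteModule.{u, v} Γ where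
  carrier := M
  action := 1
  isLocallyConstant _ := IsLocallyConstant.const _

section Groups

variable (A : DiscreteModule.{u, v} Γ)

/-- Continuous 1-cocycles. -/
def Z1 : AddSubgroup (LocallyConstant Γ A.carrier) where
  carrier := {f | ∀ s t, f (s * t) = f s + A.action s (f t)}
  zero_mem' _ _ := by simp
  add_mem' hf hg s t := by
    simp only [LocallyConstant.coe_add, Pi.add_apply, hf s t, hg s t, map_add]
    abel
  neg_mem' hf s t := by
    simp only [LocallyConstant.coe_neg, Pi.neg_apply, hf s t, map_neg]
    abel

/-- 1-coboundaries `s ↦ s m - m`. -/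
def B1 : AddSubgroup (LocallyConstant Γ A.carrier) where
  carrier := {f | ∃ m, ∀ s, f s = A.action s m - m}
  zero_mem' := ⟨0, by simp⟩
  add_mem' := by
    rintro f g ⟨m, hm⟩ ⟨n, hn⟩
    refine ⟨m + n, fun s => ?_⟩
    simp only [LocallyConstant.coe_add, Pi.add_apply, hm s, hn s, map_add]
    abel
  neg_mem' := by
    rintro f ⟨m, hm⟩
    refine ⟨-m, fun s => ?_⟩
    simp only [LocallyConstant.coe_neg, Pi.neg_apply, hm s, map_neg]
    abel

/-- Continuous 2-cocycles. -/
def Z2 : AddSubgroup (LocallyConstant (Γ × Γ) A.carrier) where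
  carrier := {f | ∀ r s t, A.action r (f (s, t)) - f (r * s, t) + f (r, s * t) - f (r, s) = 0}
  zero_mem' _ _ _ := by simp
  add_mem' {f g} hf hg r s t := by
    have h1 := hf r s t
    have h2 := hg r s t
    simp only [LocallyConstant.coe_add, Pi.add_apply, map_add]
    rw [← add_zero (0 : A.carrier)]
    nth_rewrite 1 [← h1]
    rw [← h2]
    abel
  neg_mem' {f} hf r s t := by
    have h1 := hf r s t
    simp only [LocallyConstant.coe_neg, Pi.neg_apply, map_neg]
    rw [← neg_zero, ← h1]
    abel

/-- Coboundaries of continuous 1-cochains. -/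
def B2 : AddSubgroup (LocallyConstant (Γ × Γ) A.carrier) where
  carrier := {f | ∃ c : LocallyConstant Γ A.carrier,
    ∀ s t, f (s, t) = A.action s (c t) - c (s * t) + c s}
  zero_mem' := ⟨0, by simp⟩
  add_mem' := by
    rintro f g ⟨m, hm⟩ ⟨n, hn⟩
    refine ⟨m + n, fun s t => ?_⟩
    simp only [LocallyConstant.coe_add, Pi.add_apply, hm s, hn s, map_add]
    abel
  neg_mem' := by
    rintro f ⟨m, hm⟩
    refine ⟨-m, fun s t => ?_⟩
    simp only [LocallyConstant.coe_neg, Pi.neg_apply, hm s, map_neg]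
    abel

/-- The first continuous cohomology group `H¹(Γ, A)`. -/
abbrev H1 : Type (max u v) := Z1 A ⧸ (B1 A).addSubgroupOf (Z1 A)

/-- The second continuous cohomology group `H²(Γ, A)`. -/
abbrev H2 : Type (max u v) := Z2 A ⧸ (B2 A).addSubgroupOf (Z2 A)

variable {A}

/-- The class of a continuous 1-cocycle. -/
def H1.mk : Z1 A →+ H1 A := QuotientAddGroup.mk' _

/-- The class of a continuous 2-cocycle. -/
def H2.mk : Z2 A →+ H2 A := QuotientAddGroup.mk' _

end Groups

section Functoriality

variable {A : DiscreteModule.{u, v} Γ} {Γ' : Type w} [Group Γ'] [TopologicalSpace Γ'] {A' : DiscreteModule.{w, v} Γ'}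

/-- The map on 2-cocycles induced by a continuous homomorphism `φ : Γ' → Γ` and a map of coefficients
`θ : A → A'` with `θ (φ(s) a) = s θ(a)`. -/
def Z2.map (φ : Γ' →ₜ* Γ) (θ : A.carrier →+ A'.carrier)
    (h : ∀ s a, θ (A.action (φ s) a) = A'.action s (θ a)) : Z2 A →+ Z2 A' where
  toFun f := ⟨⟨fun p => θ (f.1 (φ p.1, φ p.2)), (f.1.isLocallyConstant.comp θ).comp_continuous
      (by fun_prop : Continuous fun p : Γ' × Γ' => (φ p.1, φ p.2))⟩, fun r s t => by
    have := congrArg θ (f.2 (φ r) (φ s) (φ t))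
    simpa [h] using this⟩
  map_zero' := by ext; simp
  map_add' _ _ := by ext; simp

/-- The map `H²(Γ, A) → H²(Γ', A')` induced by a continuous homomorphism `φ : Γ' → Γ` and a map of
coefficients `θ : A → A'` with `θ (φ(s) a) = s θ(a)`. -/
def H2.map (φ : Γ' →ₜ* Γ) (θ : A.carrier →+ A'.carrier)
    (h : ∀ s a, θ (A.action (φ s) a) = A'.action s (θ a)) : H2 A →+ H2 A' :=
  QuotientAddGroup.map _ _ (Z2.map φ θ h) (by
    rintro ⟨f, hf⟩ ⟨c, hc⟩
    refine ⟨⟨fun s => θ (c (φ s)), (c.isLocallyConstant.comp θ).comp_continuous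
      (by fun_prop)⟩, fun s t => ?_⟩
    have := congrArg θ (hc (φ s) (φ t))
    simpa [Z2.map, h] using this)

end Functoriality

section Cup

variable {A : DiscreteModule.{u, v} Γ} {B : DiscreteModule.{u, v'} Γ}
  {C : DiscreteModule.{u, v''} Γ} (β : A.carrier →+ B.carrier →+ C.carrier)
  (hβ : ∀ s a b, β (A.action s a) (B.action s b) = C.action s (β a b))

/-- The cup product of two 1-cocycles, `(s, t) ↦ β(f(s), s g(t))`. -/
def Z1.cup (f : Z1 A) (g : Z1 B) : Z2 C :=
  ⟨⟨fun p => β (f.1 p.1) (B.action p.1 (g.1 p.2)), by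
      have h1 : IsLocallyConstant fun p : Γ × Γ => f.1 p.1 :=
        f.1.isLocallyConstant.comp_continuous continuous_fst
      have h2 : IsLocallyConstant fun p : Γ × Γ => g.1 p.2 :=
        g.1.isLocallyConstant.comp_continuous continuous_snd
      have h3 (b : B.carrier) : IsLocallyConstant fun p : Γ × Γ => B.action p.1 b :=
        (B.isLocallyConstant b).comp_continuous continuous_fst
      rw [IsLocallyConstant.iff_eventually_eq] at *
      intro p
      filter_upwards [h1 p, h2 p, (IsLocallyConstant.iff_eventually_eq _).1 (h3 (g.1 p.2)) p]
        with q hq1 hq2 hq3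
      rw [hq1, hq2, hq3]⟩, fun r s t => by
    have hf := f.2
    have hg := g.2
    simp only [LocallyConstant.coe_mk]
    rw [hf r s, hg s t, ← hβ]
    simp only [map_mul, map_add, AddMonoidHom.add_apply, AddMonoid.End.coe_mul, Function.comp_apply]
    abel⟩

theorem Z1.cup_apply (f : Z1 A) (g : Z1 B) (s t : Γ) :
    (Z1.cup β hβ f g).1 (s, t) = β (f.1 s) (B.action s (g.1 t)) := rfl

/-- The cup product `H¹(Γ, A) × H¹(Γ, B) → H²(Γ, C)` attached to an equivariant biadditive pairing
`β : A × B → C`. -/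
def H1.cup : H1 A →+ H1 B →+ H2 C :=
  QuotientAddGroup.lift _
    (AddMonoidHom.mk' (fun f => QuotientAddGroup.lift _
      (AddMonoidHom.mk' (fun g => (QuotientAddGroup.mk (Z1.cup β hβ f g) : H2 C)) (by
        intro g g'
        rw [← QuotientAddGroup.mk_add]
        congr 1
        ext ⟨s, t⟩
        simp [Z1.cup_apply]))
      (by
        rintro ⟨g, hg⟩ ⟨m, hm⟩
        refine (QuotientAddGroup.eq_zero_iff _).2 ?_
        refine ⟨-⟨fun s => β (f.1 s) (B.action s m),
          f.1.isLocallyConstant.comp₂ (B.isLocallyConstant m) fun a b => β a b⟩, fun s t => ?_⟩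
        · have h := f.2 s t
          change ∀ s, g s = _ at hm
          simp only [AddSubgroup.coe_subtype, Z1.cup_apply, LocallyConstant.coe_neg, Pi.neg_apply,
            LocallyConstant.coe_mk, map_neg, ← hβ]
          rw [h, hm]
          simp only [map_mul, map_add, map_sub, AddMonoidHom.add_apply, AddMonoid.End.coe_mul, Function.comp_apply]
          abel))
      (by
        intro f f'
        refine QuotientAddGroup.addMonoidHom_ext _ (AddMonoidHom.ext fun g => ?_)
        change (QuotientAddGroup.mk (Z1.cup β hβ (f + f') g) : H2 C) =
          QuotientAddGroup.mk (Z1.cup β hβ f g + Z1.cup β hβ f' g)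
        congr 1
        ext ⟨s, t⟩
        simp [Z1.cup_apply]))
    (by
      rintro ⟨f, hf⟩ ⟨m, hm⟩
      refine QuotientAddGroup.addMonoidHom_ext _ (AddMonoidHom.ext fun g => ?_)
      refine (QuotientAddGroup.eq_zero_iff _).2 ?_
      refine ⟨⟨fun s => β m (g.1 s), g.1.isLocallyConstant.comp _⟩, fun s t => ?_⟩
      have h := g.2 s t
      change ∀ s, f s = _ at hm
      simp only [AddSubgroup.coe_subtype, Z1.cup_apply, LocallyConstant.coe_mk, ← hβ]
      rw [h, hm]
      simp only [map_add, map_sub, AddMonoidHom.sub_apply]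
      abel)

end Cup

end ContCohomology

/-! ### The classifying stack of a finite constant group and its Brauer group -/

namespace ClassifyingStack

open scoped TensorProduct Topology
open ContCohomology

universe uk uG uR uB uC uR' uB' uR'' uB'' uM

section Torsors

/-- The map `B ⊗ B → ∏_{g ∈ G} B`, `x ⊗ y ↦ (x · g y)_g`; on spectra it is the map
`P × G → P ×_{Spec R} P`, `(p, g) ↦ (p, p g)`, for `P = Spec B`. -/
def torsorMap (G : Type uG) [Group G] (R : Type uR) [CommRing R] (B : Type uB) [CommRing B]
    [Algebra R B] [MulSemiringAction G B] [SMulCommClass G R B] :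
    B ⊗[R] B →ₐ[B] (G → B) :=
  AlgHom.pi fun g =>
    Algebra.TensorProduct.lift (AlgHom.id B B) (MulSemiringAction.toAlgHom R B g)
      fun _ _ => Commute.all _ _

@[simp]
theorem torsorMap_tmul (G : Type uG) [Group G] (R : Type uR) [CommRing R] (B : Type uB)
    [CommRing B] [Algebra R B] [MulSemiringAction G B] [SMulCommClass G R B] (x y : B) (g : G) :
    torsorMap G R B (x ⊗ₜ y) g = x * g • y := by
  simp [torsorMap]

/-- `Spec B → Spec R` is a torsor under the finite constant group `G` (acting on the right on `Spec B`,
hence on the left on `B`): it is faithfully flat and `P × G → P ×_{Spec R} P` is an isomorphism.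
(All `G`-torsors over `Spec R` are affine, since `G` is finite.) -/
class IsTorsor (G : Type uG) [Group G] (R : Type uR) [CommRing R] (B : Type uB) [CommRing B]
    [Algebra R B] [MulSemiringAction G B] [SMulCommClass G R B] : Prop where
  faithfullyFlat : Module.FaithfullyFlat R B
  bijective : Function.Bijective (torsorMap G R B)

/-- The coordinate ring of the trivial torsor `G × Spec R`, with `(g f)(h) = f(h g)`. -/
def Trivial (G : Type uG) (R : Type uR) : Type (max uG uR) := G → R

noncomputable instance (G : Type uG) (R : Type uR) [CommRing R] : CommRing (Trivial G R) :=
  inferInstanceAs (CommRing (G → R))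

noncomputable instance (G : Type uG) (R : Type uR) [CommRing R] : Algebra R (Trivial G R) :=
  inferInstanceAs (Algebra R (G → R))

instance (G : Type uG) [Group G] (R : Type uR) [CommRing R] :
    MulSemiringAction G (Trivial G R) where
  smul g f := fun h => f (h * g)
  one_smul f := funext fun h => congrArg f (mul_one h)
  mul_smul a b f := funext fun h => congrArg f (mul_assoc h a b).symm
  smul_zero _ := rfl
  smul_add _ _ _ := rfl
  smul_one _ := rfl
  smul_mul _ _ _ := rfl

instance (G : Type uG) [Group G] (R : Type uR) [CommRing R] :
    SMulCommClass G R (Trivial G R) where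
  smul_comm _ _ _ := rfl

/-- The `R`-point `h` of the trivial torsor. -/
def Trivial.eval {G : Type uG} (R : Type uR) [CommRing R] (h : G) : Trivial G R →ₐ[R] R :=
  Pi.evalAlgHom R (fun _ : G => R) h

theorem Trivial.eval_smul {G : Type uG} [Group G] (R : Type uR) [CommRing R] (g h : G)
    (f : Trivial G R) : Trivial.eval R h (g • f) = Trivial.eval R (h * g) f := rfl

instance Trivial.isTorsor (G : Type uG) [Group G] [Finite G] (R : Type uR) [CommRing R]
    [Nontrivial R] : IsTorsor G R (Trivial G R) where
  faithfullyFlat := by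
    have : Nontrivial (Trivial G R) := inferInstanceAs (Nontrivial (G → R))
    have : Module.Free R (Trivial G R) := inferInstanceAs (Module.Free R (G → R))
    infer_instance
  bijective := by
    classical
    have := Fintype.ofFinite G
    let b : Module.Basis G R (Trivial G R) := Pi.basisFun R G
    have hb : ∀ x h, b x h = if h = x then 1 else 0 := fun x h => by
      change Pi.basisFun R G x h = _
      simp [Pi.single_apply]
    let bb := Algebra.TensorProduct.basis (Trivial G R) b
    have key : ∀ (f : G → Trivial G R) (g h : G),
        torsorMap G R (Trivial G R) (∑ x, f x • bb x) g h = f (h * g) h := by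
      intro f g h
      have h1 : ∀ x, torsorMap G R (Trivial G R) (f x • bb x) g = f x * g • b x := by
        intro x
        simp [bb]
      rw [map_sum, Finset.sum_apply]
      simp only [h1]
      change Trivial.eval R h (∑ x, f x * g • b x) = _
      rw [map_sum]
      have h2 : ∀ x, Trivial.eval R h (f x * g • b x) =
          f x h * (if h * g = x then 1 else 0) := by
        intro x
        rw [← hb]
        rfl
      simp only [h2]
      simp
    constructor
    · rw [injective_iff_map_eq_zero]
      intro z hz
      rw [← bb.sum_repr z] at hz ⊢
      refine Finset.sum_eq_zero fun x _ => ?_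
      have h0 : bb.repr z x = 0 := by
        funext h
        have := key (fun x => bb.repr z x) (h⁻¹ * x) h
        rw [hz, mul_inv_cancel_left] at this
        exact this.symm
      rw [h0, zero_smul]
    · intro F
      refine ⟨∑ x, (show Trivial G R from fun h => F (h⁻¹ * x) h) • bb x, ?_⟩
      funext g h
      rw [key (fun x => (show Trivial G R from fun h => F (h⁻¹ * x) h))]
      simp

/-- A finite Galois extension of fields with group `G` is a `G`-torsor. -/
theorem isTorsor_of_isGalois (G : Type uG) [Group G] (k : Type uR) [Field k] (K : Type uB)
    [Field K] [Algebra k K] [FiniteDimensional k K] [IsGalois k K] [MulSemiringAction G K]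
    [SMulCommClass G k K]
    (h : Function.Bijective (MulSemiringAction.toAlgEquiv (G := G) k K)) :
    IsTorsor G k K where
  faithfullyFlat := inferInstance
  bijective := by
    classical
    have : Finite G := Finite.of_injective _ h.1
    have := Fintype.ofFinite G
    have hcard : Module.finrank k K = Fintype.card G := by
      rw [← IsGalois.card_aut_eq_finrank, ← Nat.card_eq_fintype_card]
      exact (Nat.card_congr (Equiv.ofBijective _ h)).symm
    have hdim : Module.finrank K (K ⊗[k] K) = Module.finrank K (G → K) := by
      rw [Module.finrank_baseChange, Module.finrank_pi, hcard]
    have hsurj : Function.Surjective (torsorMap G k K).toLinearMap := by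
      rw [← LinearMap.range_eq_top]
      by_contra hne
      obtain ⟨f, hf0, hf⟩ := Submodule.exists_le_ker_of_lt_top _ (lt_top_iff_ne_top.2 hne)
      apply hf0
      have hli : LinearIndependent K
          (fun g : G => (MulSemiringAction.toAlgHom k K g).toLinearMap) := by
        refine (linearIndependent_toLinearMap k K K).comp
          (fun g : G => MulSemiringAction.toAlgHom k K g) ?_
        intro a b hab
        apply h.1
        ext x
        exact DFunLike.congr_fun hab x
      have hz : ∀ g, f (Pi.single g 1) = 0 := by
        apply Fintype.linearIndependent_iff.1 hli
        ext y
        have h1 : f (torsorMap G k K (1 ⊗ₜ y)) = 0 :=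
          LinearMap.mem_ker.1 (hf ⟨1 ⊗ₜ y, rfl⟩)
        have h2 : torsorMap G k K (1 ⊗ₜ y) =
            ∑ g : G, (g • y) • (Pi.single g (1 : K) : G → K) := by
          funext g'
          simp [Pi.single_apply]
        rw [h2, map_sum] at h1
        simpa [mul_comm] using h1
      refine LinearMap.pi_ext' fun g => LinearMap.ext_ring ?_
      simpa using hz g
    exact ⟨(LinearMap.injective_iff_surjective_of_finrank_eq_finrank hdim).2 hsurj, hsurj⟩


/-- The coordinate ring `S ⊗ B` of the pullback to `Spec S` of `Spec B → Spec R`. -/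
def BaseChange (R : Type uR) [CommRing R] (S : Type uC) [CommRing S] [Algebra R S]
    (B : Type uB) [CommRing B] [Algebra R B] : Type (max uB uC) := S ⊗[R] B

section BaseChange

variable (G : Type uG) [Group G] (R : Type uR) [CommRing R] (S : Type uC) [CommRing S]
  [Algebra R S] (B : Type uB) [CommRing B] [Algebra R B] [MulSemiringAction G B]
  [SMulCommClass G R B]

noncomputable instance : CommRing (BaseChange R S B) := inferInstanceAs (CommRing (S ⊗[R] B))

noncomputable instance : Algebra S (BaseChange R S B) := inferInstanceAs (Algebra S (S ⊗[R] B))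

/-- `g` acts on `S ⊗ B` through the second factor. -/
noncomputable def BaseChange.smulAlgHom (g : G) : BaseChange R S B →ₐ[S] BaseChange R S B :=
  (Algebra.TensorProduct.map (AlgHom.id S S) (MulSemiringAction.toAlgHom R B g) :
    S ⊗[R] B →ₐ[S] S ⊗[R] B)

/-- A pure tensor. -/
noncomputable def BaseChange.tmul (s : S) (b : B) : BaseChange R S B := s ⊗ₜ[R] b

variable {B} in
@[elab_as_elim]
theorem BaseChange.induction {P : BaseChange R S B → Prop} (zero : P 0)
    (tmul : ∀ s b, P (BaseChange.tmul R S B s b)) (add : ∀ x y, P x → P y → P (x + y))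
    (z : BaseChange R S B) : P z :=
  TensorProduct.induction_on (motive := P) z zero tmul add

theorem BaseChange.smulAlgHom_tmul (g : G) (s : S) (b : B) :
    BaseChange.smulAlgHom G R S B g (.tmul R S B s b) = .tmul R S B s (g • b) :=
  Algebra.TensorProduct.map_tmul _ _ _ _

/-- `G` acts on `S ⊗ B` through the second factor. -/
noncomputable instance : MulSemiringAction G (BaseChange R S B) where
  smul g := BaseChange.smulAlgHom G R S B g
  one_smul z := by
    change BaseChange.smulAlgHom G R S B 1 z = z
    induction z using BaseChange.induction with
    | zero => exact map_zero _
    | tmul s b => rw [BaseChange.smulAlgHom_tmul, one_smul]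
    | add x y hx hy => rw [map_add, hx, hy]
  mul_smul g h z := by
    change BaseChange.smulAlgHom G R S B (g * h) z =
      BaseChange.smulAlgHom G R S B g (BaseChange.smulAlgHom G R S B h z)
    induction z using BaseChange.induction with
    | zero => simp only [map_zero]
    | tmul s b => simp only [BaseChange.smulAlgHom_tmul, mul_smul]
    | add x y hx hy => simp only [map_add, hx, hy]
  smul_zero g := map_zero (BaseChange.smulAlgHom G R S B g)
  smul_add g := map_add (BaseChange.smulAlgHom G R S B g)
  smul_one g := map_one (BaseChange.smulAlgHom G R S B g)
  smul_mul g := map_mul (BaseChange.smulAlgHom G R S B g)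

theorem BaseChange.smul_tmul (g : G) (s : S) (b : B) :
    g • BaseChange.tmul R S B s b = .tmul R S B s (g • b) :=
  BaseChange.smulAlgHom_tmul G R S B g s b

instance : SMulCommClass G S (BaseChange R S B) where
  smul_comm g s z := map_smul (BaseChange.smulAlgHom G R S B g) s z

instance BaseChange.isTorsor [Finite G] [h : IsTorsor G R B] :
    IsTorsor G S (BaseChange R S B) where
  faithfullyFlat := by
    have := h.faithfullyFlat
    exact inferInstanceAs (Module.FaithfullyFlat S (S ⊗[R] B))
  bijective := by
    classical
    have := Fintype.ofFinite G
    let t : (B ⊗[R] B) ≃ₗ[R] (G → B) := LinearEquiv.ofBijective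
      ((torsorMap G R B).toLinearMap.restrictScalars R) h.bijective
    let e : (S ⊗[R] B) ⊗[S] (S ⊗[R] B) ≃ₗ[S] (G → S ⊗[R] B) :=
      (TensorProduct.AlgebraTensorModule.distribBaseChange R S B B).symm ≪≫ₗ
        t.baseChange R S _ _ ≪≫ₗ TensorProduct.piRight R S S (fun _ : G => B)
    have he : ∀ (s s' : S) (b b' : B),
        torsorMap G S (BaseChange R S B) ((.tmul R S B s b) ⊗ₜ (.tmul R S B s' b')) =
          e ((s ⊗ₜ b) ⊗ₜ (s' ⊗ₜ b')) := by
      intro s s' b b'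
      funext g
      rw [torsorMap_tmul, BaseChange.smul_tmul]
      simp only [e, LinearEquiv.trans_apply,
        TensorProduct.AlgebraTensorModule.distribBaseChange_symm_tmul]
      refine (Algebra.TensorProduct.tmul_mul_tmul (R := R) s s' b (g • b')).trans ?_
      change _ = (s * s') ⊗ₜ[R] (torsorMap G R B (b ⊗ₜ b') g)
      rw [torsorMap_tmul]
    have : (torsorMap G S (BaseChange R S B) : _ → _) = e := by
      funext z
      refine TensorProduct.induction_on z ?_ ?_ ?_
      · exact (map_zero _).trans (map_zero e).symm
      · intro x y
        induction x using BaseChange.induction with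
        | zero =>
          rw [TensorProduct.zero_tmul]
          exact (map_zero _).trans (map_zero e).symm
        | add x x' hx hx' =>
          rw [TensorProduct.add_tmul, map_add, hx, hx']
          exact (map_add e _ _).symm
        | tmul s b =>
          induction y using BaseChange.induction with
          | zero =>
            rw [TensorProduct.tmul_zero]
            exact (map_zero _).trans (map_zero e).symm
          | add x x' hx hx' =>
            rw [TensorProduct.tmul_add, map_add, hx, hx']
            exact (map_add e _ _).symm
          | tmul s' b' => exact he s s' b b'
      · intro x y hx hy
        rw [map_add, hx, hy]
        exact (map_add e _ _).symm
    rw [this]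
    exact e.bijective

end BaseChange

theorem exists_trivialization (G : Type uG) [Group G] [Finite G] (Ω : Type uR) [Field Ω]
    [IsAlgClosed Ω] (B : Type uB) [CommRing B] [Algebra Ω B] [MulSemiringAction G B]
    [SMulCommClass G Ω B] [h : IsTorsor G Ω B] :
    ∃ e : B ≃ₐ[Ω] Trivial G Ω, ∀ (g : G) (b : B), e (g • b) = g • e b := by
  classical
  have := Fintype.ofFinite G
  have := h.faithfullyFlat
  have : Nontrivial B := (TensorProduct.lid Ω B).toEquiv.symm.nontrivial
  let t : (B ⊗[Ω] B) ≃ₗ[B] (G → B) := LinearEquiv.ofBijective (torsorMap G Ω B).toLinearMap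
    h.bijective
  have hrank : Module.finrank Ω B = Fintype.card G := by
    rw [← Module.finrank_baseChange (R := B), t.finrank_eq, Module.finrank_pi]
  have hfin : FiniteDimensional Ω B :=
    FiniteDimensional.of_finrank_pos (hrank ▸ Fintype.card_pos)
  obtain ⟨p⟩ : Nonempty (B →ₐ[Ω] Ω) := by
    obtain ⟨m, hm⟩ := Ideal.exists_maximal B
    let _ := Ideal.Quotient.field m
    have : Algebra.IsAlgebraic Ω (B ⧸ m) := inferInstance
    exact ⟨(IsAlgClosed.lift : (B ⧸ m) →ₐ[Ω] Ω).comp (Ideal.Quotient.mkₐ Ω m)⟩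
  let e : B →ₐ[Ω] Trivial G Ω := (AlgHom.pi fun g : G =>
    p.comp (MulSemiringAction.toAlgHom Ω B g) : B →ₐ[Ω] (G → Ω))
  have hs : Function.Surjective e := by
    intro f
    obtain ⟨z, hz⟩ := h.bijective.2 fun g => algebraMap Ω B (f g)
    have : ∀ z, ∃ b, ∀ g, p (torsorMap G Ω B z g) = p (g • b) := by
      intro z
      induction z using TensorProduct.induction_on with
      | zero => exact ⟨0, by simp⟩
      | tmul x y => exact ⟨p x • y, by simp [smul_comm]⟩
      | add x y hx hy =>
        obtain ⟨b, hb⟩ := hx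
        obtain ⟨c, hc⟩ := hy
        exact ⟨b + c, by simp [hb, hc]⟩
    obtain ⟨b, hb⟩ := this z
    refine ⟨b, funext fun g => ?_⟩
    have := hb g
    rw [hz, AlgHom.commutes] at this
    exact this.symm
  have hd : Module.finrank Ω B = Module.finrank Ω (Trivial G Ω) := by
    rw [hrank]
    exact (Module.finrank_pi Ω).symm
  have : FiniteDimensional Ω (Trivial G Ω) := inferInstanceAs (FiniteDimensional Ω (G → Ω))
  refine ⟨AlgEquiv.ofBijective e
    ⟨(LinearMap.injective_iff_surjective_of_finrank_eq_finrank (f := e.toLinearMap) hd).2 hs, hs⟩,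
    fun g b => funext fun x => ?_⟩
  change p (x • g • b) = p ((x * g) • b)
  rw [mul_smul]

end Torsors

/-- A `G`-torsor over `Spec R`, given by its coordinate ring `B`. -/
structure Torsor (G : Type uG) [Group G] (R : Type uR) [CommRing R] where
  B : Type uB
  [commRing : CommRing B]
  [algebra : Algebra R B]
  [action : MulSemiringAction G B]
  [smulComm : SMulCommClass G R B]
  [isTorsor : IsTorsor G R B]

attribute [instance] Torsor.commRing Torsor.algebra Torsor.action Torsor.smulComm Torsor.isTorsor

/-- Objects of the classifying stack `BG = [Spec k / G]`, as a fibred category over affine `k`-schemes: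
the objects over `Spec R` are the `G`-torsors over `Spec R`. -/
structure BG (k : Type uk) [Field k] (G : Type uG) [Group G] where
  R : Type uR
  [commRing : CommRing R]
  [algebra : Algebra k R]
  torsor : Torsor.{uG, uR, uB} G R

attribute [instance] BG.commRing BG.algebra

namespace BG

variable {k : Type uk} [Field k] {G : Type uG} [Group G]

/-- Isomorphisms in the fibred category `BG`: an isomorphism of the bases over `k` and a `G`-equivariant
isomorphism of the torsors above it. They are written on coordinate rings. Those with
`base = refl` are the isomorphisms of the groupoid `BG(R)`. -/
@[ext]
structure Iso (X : BG.{uk, uG, uR, uB} k G) (Y : BG.{uk, uG, uR', uB'} k G) where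
  base : X.R ≃ₐ[k] Y.R
  total : X.torsor.B ≃+* Y.torsor.B
  total_algebraMap (r : X.R) :
    total (algebraMap X.R X.torsor.B r) = algebraMap Y.R Y.torsor.B (base r)
  total_smul (g : G) (b : X.torsor.B) : total (g • b) = g • total b

namespace Iso

def refl (X : BG.{uk, uG, uR, uB} k G) : Iso X X where
  base := AlgEquiv.refl
  total := RingEquiv.refl _
  total_algebraMap _ := rfl
  total_smul _ _ := rfl

variable {X : BG.{uk, uG, uR, uB} k G} {Y : BG.{uk, uG, uR', uB'} k G}
  {Z : BG.{uk, uG, uR'', uB''} k G}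

def symm (e : Iso X Y) : Iso Y X where
  base := e.base.symm
  total := e.total.symm
  total_algebraMap r := by
    rw [RingEquiv.symm_apply_eq, e.total_algebraMap, AlgEquiv.apply_symm_apply]
  total_smul g b := by
    rw [RingEquiv.symm_apply_eq, e.total_smul, RingEquiv.apply_symm_apply]

def trans (e : Iso X Y) (f : Iso Y Z) : Iso X Z where
  base := e.base.trans f.base
  total := e.total.trans f.total
  total_algebraMap r := by simp [e.total_algebraMap, f.total_algebraMap]
  total_smul g b := by simp [e.total_smul, f.total_smul]

end Iso

/-- The automorphism group, in the fibred category `BG`, of an object `X`: automorphisms of the base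
over `k` together with a lift to the torsor. It acts from the left on the coordinate rings. -/
abbrev Aut (X : BG.{uk, uG, uR, uB} k G) : Type (max uR uB) := Iso X X

section Aut

variable (X : BG.{uk, uG, uR, uB} k G)

/-- `s * t` is `s` after `t`, as maps of coordinate rings. -/
instance : Group (Aut X) where
  mul s t := t.trans s
  one := Iso.refl X
  inv s := s.symm
  mul_assoc _ _ _ := rfl
  one_mul _ := rfl
  mul_one _ := rfl
  inv_mul_cancel s := by
    refine Iso.ext (AlgEquiv.ext fun r => ?_) (RingEquiv.ext fun b => ?_)
    · exact s.base.symm_apply_apply r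
    · exact s.total.symm_apply_apply b

variable {X}

theorem mul_base (s t : Aut X) (r : X.R) : (s * t).base r = s.base (t.base r) := rfl

theorem mul_total (s t : Aut X) (b : X.torsor.B) : (s * t).total b = s.total (t.total b) := rfl

/-- The topology of pointwise convergence on the (discrete) coordinate rings. -/
instance : TopologicalSpace (Aut X) :=
  (⨅ r : X.R, TopologicalSpace.induced (fun s : Aut X => s.base r) ⊥) ⊓
    ⨅ b : X.torsor.B, TopologicalSpace.induced (fun s : Aut X => s.total b) ⊥

theorem isLocallyConstant_base (r : X.R) : IsLocallyConstant fun s : Aut X => s.base r := by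
  intro U
  have h : IsOpen[TopologicalSpace.induced (fun s : Aut X => s.base r) ⊥]
      ((fun s : Aut X => s.base r) ⁻¹' U) := isOpen_induced (t := ⊥) trivial
  have hle : (inferInstance : TopologicalSpace (Aut X)) ≤
      TopologicalSpace.induced (fun s : Aut X => s.base r) ⊥ := inf_le_left.trans (iInf_le _ r)
  exact hle _ h

theorem isLocallyConstant_total (b : X.torsor.B) :
    IsLocallyConstant fun s : Aut X => s.total b := by
  intro U
  have h : IsOpen[TopologicalSpace.induced (fun s : Aut X => s.total b) ⊥]
      ((fun s : Aut X => s.total b) ⁻¹' U) := isOpen_induced (t := ⊥) trivial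
  have hle : (inferInstance : TopologicalSpace (Aut X)) ≤
      TopologicalSpace.induced (fun s : Aut X => s.total b) ⊥ := inf_le_right.trans (iInf_le _ b)
  exact hle _ h

theorem continuous_aut {T : Type*} [TopologicalSpace T] {f : T → Aut X}
    (h₁ : ∀ r, IsLocallyConstant fun t => (f t).base r)
    (h₂ : ∀ b, IsLocallyConstant fun t => (f t).total b) : Continuous f := by
  refine continuous_inf_rng.2 ⟨continuous_iInf_rng.2 fun r => ?_,
    continuous_iInf_rng.2 fun b => ?_⟩
  · exact continuous_induced_rng.2 (@IsLocallyConstant.continuous _ _ _ ⊥ _ (h₁ r))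
  · exact continuous_induced_rng.2 (@IsLocallyConstant.continuous _ _ _ ⊥ _ (h₂ b))

/-- An isomorphism `X ≅ Y` identifies the automorphism groups. -/
def Iso.conj {Y : BG.{uk, uG, uR', uB'} k G} (e : Iso X Y) : Aut X →ₜ* Aut Y where
  toFun s := (e.symm.trans s).trans e
  map_one' := by
    refine Iso.ext (AlgEquiv.ext fun r => ?_) (RingEquiv.ext fun b => ?_)
    · exact e.base.apply_symm_apply r
    · exact e.total.apply_symm_apply b
  map_mul' s t := by
    refine Iso.ext (AlgEquiv.ext fun r => ?_) (RingEquiv.ext fun b => ?_)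
    · exact congrArg (fun x => e.base (s.base x)) (e.base.symm_apply_apply _).symm
    · exact congrArg (fun x => e.total (s.total x)) (e.total.symm_apply_apply _).symm
  continuous_toFun := continuous_aut
    (fun r => (isLocallyConstant_base (e.base.symm r)).comp e.base)
    (fun b => (isLocallyConstant_total (e.total.symm b)).comp e.total)

end Aut

section Sheaves

variable (X : BG.{uk, uG, uR, uB} k G)

/-- The sections of the sheaf `𝔾ₘ` over `X`, with the action of the automorphisms of `X`. -/
abbrev Gm : DiscreteModule.{max uR uB, uR} (Aut X) where
  carrier := Additive X.Rˣ
  action :=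
    { toFun := fun s => MonoidHom.toAdditive (Units.map (s.base : X.R →* X.R))
      map_one' := rfl
      map_mul' := fun _ _ => rfl }
  isLocallyConstant u :=
    IsLocallyConstant.desc _ (fun v : Additive X.Rˣ => (v.toMul : X.R))
      (isLocallyConstant_base (u.toMul : X.R))
      fun _ _ h => Units.ext h

/-- The sections of the sheaf `μₙ` over `X`, with the action of the automorphisms of `X`. -/
abbrev mu (n : ℕ) : DiscreteModule.{max uR uB, uR} (Aut X) where
  carrier := Additive (rootsOfUnity n X.R)
  action :=
    { toFun := fun s => MonoidHom.toAdditive (restrictRootsOfUnity s.base n)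
      map_one' := by ext; rfl
      map_mul' := fun _ _ => by ext; rfl }
  isLocallyConstant u :=
    IsLocallyConstant.desc _ (fun v : Additive (rootsOfUnity n X.R) => ((v.toMul : X.Rˣ) : X.R))
      (isLocallyConstant_base ((u.toMul : X.Rˣ) : X.R))
      fun _ _ h => Subtype.ext (Units.ext h)

/-- The sections of the constant sheaf `M` over an object `X` with connected base. -/
abbrev const (M : Type uM) [AddCommGroup M] : DiscreteModule.{max uR uB, uM} (Aut X) :=
  DiscreteModule.trivial (Aut X) M

/-- The inclusion `μₙ → 𝔾ₘ`. -/
def muToGm (n : ℕ) : (mu X n).carrier →+ (Gm X).carrier :=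
  (MonoidHom.toAdditive (rootsOfUnity n X.R).subtype :
    Additive (rootsOfUnity n X.R) →+ Additive X.Rˣ)

theorem muToGm_action (n : ℕ) (s : Aut X) (a : (mu X n).carrier) :
    muToGm X n ((mu X n).action s a) = (Gm X).action s (muToGm X n a) := rfl

end Sheaves

end BG

section ClassifyingStackCohomology

variable (k : Type uk) [Field k] (G : Type uG) [Group G] [Finite G]

/-- The geometric point `x̄ : Spec k̄ → Spec k → BG = [Spec k / G]`: the trivial torsor over `k̄`.

For `k` perfect and `G` finite, `x̄` is a pro-étale Galois covering of `BG` with group `Π = Aut x̄`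
(an extension of the absolute Galois group of `k` by `G`), so `F ↦ F(x̄)` is an equivalence of the
étale sheaves of abelian groups on `BG` with the discrete `Π`-modules, and the étale cohomology
group `Hⁱ(BG, F)` is the `i`-th cohomology group of the complex of continuous cochains of `Π`
with values in `F(x̄)`. Below, `Hⁱ(BG, F)` is defined by that complex. -/
noncomputable abbrev geometricPoint : BG.{uk, uG, uk, max uG uk} k G where
  R := AlgebraicClosure k
  torsor := { B := Trivial G (AlgebraicClosure k) }

variable {k G}

theorem exists_monodromy (s : BG.Aut (geometricPoint k G)) :
    ∃ c : G, ∀ f : Trivial G (AlgebraicClosure k),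
      Trivial.eval _ 1 (s.total f) = s.base (Trivial.eval _ c f) := by
  classical
  have := Fintype.ofFinite G
  let δ (c : G) : Trivial G (AlgebraicClosure k) :=
    (Pi.single c 1 : G → AlgebraicClosure k)
  let ψ : Trivial G (AlgebraicClosure k) →+* AlgebraicClosure k :=
    (Trivial.eval (AlgebraicClosure k) (1 : G)).toRingHom.comp s.total.toRingHom
  have hψ (f) : Trivial.eval _ 1 (s.total f) = ψ f := rfl
  have hsum : ∑ c, δ c = 1 := Finset.univ_sum_single (1 : G → AlgebraicClosure k)
  obtain ⟨c, hc⟩ : ∃ c, ψ (δ c) ≠ 0 := by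
    by_contra! h
    have := congrArg ψ hsum
    rw [map_sum, map_one, Finset.sum_eq_zero fun c _ => h c] at this
    exact zero_ne_one this
  refine ⟨c, fun f => ?_⟩
  rw [hψ]
  apply mul_right_cancel₀ hc
  have h1 : f * δ c = algebraMap _ _ (Trivial.eval _ c f) * δ c := by
    funext x
    change f x * δ c x = f c * δ c x
    by_cases hx : x = c
    · rw [hx]
    · have : δ c x = 0 := Pi.single_eq_of_ne hx _
      rw [this, mul_zero, mul_zero]
  rw [← map_mul, h1, map_mul]
  congr 1
  exact congrArg (Trivial.eval _ (1 : G)) (s.total_algebraMap (Trivial.eval _ c f))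

/-- The value at `s` of the cocycle of the tautological torsor on `BG`: its fibre at `x̄` is the torsor
`x̄` itself, and `s` moves the section `1` of the trivial torsor to the section `monodromy s`. -/
noncomputable def monodromy (s : BG.Aut (geometricPoint k G)) : G :=
  (exists_monodromy s).choose

theorem monodromy_spec (s : BG.Aut (geometricPoint k G))
    (f : Trivial G (AlgebraicClosure k)) :
    Trivial.eval _ 1 (s.total f) = s.base (Trivial.eval _ (monodromy s) f) :=
  (exists_monodromy s).choose_spec f

theorem monodromy_unique (s : BG.Aut (geometricPoint k G)) (c : G)
    (h : ∀ f : Trivial G (AlgebraicClosure k),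
      Trivial.eval _ 1 (s.total f) = s.base (Trivial.eval _ c f)) :
    monodromy s = c := by
  classical
  by_contra hne
  have h1 := (monodromy_spec s _).symm.trans
    (h (Pi.single c 1 : G → AlgebraicClosure k))
  have h2 := s.base.injective h1
  change (Pi.single c 1 : G → AlgebraicClosure k) (monodromy s) =
    (Pi.single c 1 : G → AlgebraicClosure k) c at h2
  rw [Pi.single_eq_of_ne hne, Pi.single_eq_same] at h2
  exact zero_ne_one h2

theorem monodromy_mul (s t : BG.Aut (geometricPoint k G)) :
    monodromy (s * t) = monodromy t * monodromy s := by
  apply monodromy_unique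
  intro f
  rw [BG.mul_total, monodromy_spec s, BG.mul_base]
  congr 1
  have h := Trivial.eval_smul (AlgebraicClosure k) (monodromy s) 1 (t.total f)
  rw [one_mul] at h
  rw [← h, ← t.total_smul, monodromy_spec t]
  exact congrArg t.base (Trivial.eval_smul _ _ _ _)

theorem isLocallyConstant_monodromy :
    IsLocallyConstant (monodromy : BG.Aut (geometricPoint k G) → G) := by
  classical
  rw [IsLocallyConstant.iff_eventually_eq]
  intro s
  let δ : Trivial G (AlgebraicClosure k) :=
    (Pi.single (monodromy s) 1 : G → AlgebraicClosure k)
  filter_upwards [(BG.isLocallyConstant_total (X := geometricPoint k G) δ).eventually_eq s]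
    with t ht
  by_contra hne
  have h1 := monodromy_spec t δ
  rw [ht, monodromy_spec s δ] at h1
  have h2 : Trivial.eval _ (monodromy s) δ = 1 :=
    Pi.single_eq_same (M := fun _ : G => AlgebraicClosure k) _ _
  have h3 : Trivial.eval _ (monodromy t) δ = 0 := Pi.single_eq_of_ne hne _
  rw [h2, h3, map_one, map_zero] at h1
  exact one_ne_zero h1

end ClassifyingStackCohomology

section Classes

variable (k : Type uk) [Field k]

/-- The class `[π] ∈ H¹(BG, G)` of the universal torsor `π : Spec k → BG`, for `G` commutative. -/
noncomputable def universalTorsorClass (G : Type uG) [CommGroup G] [Finite G] :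
    H1 (BG.const (geometricPoint k G) (Additive G)) :=
  H1.mk ⟨⟨fun s => (Additive.ofMul (monodromy s) : Additive G),
    isLocallyConstant_monodromy.comp Additive.ofMul⟩, fun s t => by
      change Additive.ofMul (monodromy (s * t)) =
        Additive.ofMul (monodromy s) + Additive.ofMul (monodromy t)
      rw [monodromy_mul, mul_comm, ofMul_mul]⟩

variable {k}

theorem exists_unit_root (n : ℕ) [NeZero n] (a : kˣ) :
    ∃ b : (AlgebraicClosure k)ˣ, b ^ n = Units.map (algebraMap k (AlgebraicClosure k)) a := by
  obtain ⟨b, hb⟩ := IsAlgClosed.exists_pow_nat_eq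
    (algebraMap k (AlgebraicClosure k) a) (NeZero.pos n)
  have hb0 : b ≠ 0 := by
    rintro rfl
    rw [zero_pow (NeZero.ne n)] at hb
    exact a.ne_zero ((map_eq_zero _).1 hb.symm)
  exact ⟨Units.mk0 b hb0, Units.ext hb⟩

/-- The class in `H¹(BG, μₙ)` of `a ∈ kˣ`, that is the image of `a` under the connecting map
`H⁰(BG, 𝔾ₘ) → H¹(BG, μₙ)` of the Kummer sequence: `s ↦ s(b) / b`, where `bⁿ = a`. -/
noncomputable def kummerClass (G : Type uG) [Group G] [Finite G] (n : ℕ) [NeZero n] (a : kˣ) :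
    H1 (BG.mu (geometricPoint k G) n) :=
  let b := (exists_unit_root n a).choose
  let σ (s : BG.Aut (geometricPoint k G)) : (AlgebraicClosure k)ˣ →* (AlgebraicClosure k)ˣ :=
    Units.map (s.base : AlgebraicClosure k →* AlgebraicClosure k)
  H1.mk ⟨⟨fun s => Additive.ofMul ⟨σ s b / b, by
      have hb : b ^ n = _ := (exists_unit_root n a).choose_spec
      rw [mem_rootsOfUnity, div_pow, ← map_pow, hb, div_eq_one]
      exact Units.ext (s.base.commutes _)⟩, by
      refine IsLocallyConstant.desc _
        (fun v : Additive (rootsOfUnity n (AlgebraicClosure k)) =>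
          ((v.toMul : (AlgebraicClosure k)ˣ) : AlgebraicClosure k)) ?_
        fun _ _ h => Subtype.ext (Units.ext h)
      exact (BG.isLocallyConstant_base (X := geometricPoint k G)
        (b : AlgebraicClosure k)).comp fun x => x * ((b⁻¹ : (AlgebraicClosure k)ˣ) :
          AlgebraicClosure k)⟩, fun s t => by
      refine Subtype.ext (?_ : σ (s * t) b / b = σ s b / b * σ s (σ t b / b))
      have : σ (s * t) b = σ s (σ t b) := rfl
      rw [this, map_div, div_mul_div_cancel']⟩


end Classes

section Specialisation

variable {k : Type uk} [Field k] {G : Type uG} [Group G]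

/-- A `G`-torsor `p` over `k` is a `k`-point of `BG`; this is its composition with `Spec k̄ → Spec k`. -/
noncomputable abbrev Torsor.geometricFibre (p : Torsor.{uG, uk, uB} G k) [Finite G] :
    BG.{uk, uG, uk, max uB uk} k G where
  R := AlgebraicClosure k
  torsor := { B := BaseChange k (AlgebraicClosure k) p.B }


variable [Finite G] (p : Torsor.{uG, uk, uB} G k)

theorem Torsor.exists_iso_geometricPoint :
    ∃ e : BG.Iso p.geometricFibre (geometricPoint k G), e.base = AlgEquiv.refl := by
  obtain ⟨e, he⟩ := exists_trivialization G (AlgebraicClosure k)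
    (BaseChange k (AlgebraicClosure k) p.B)
  exact ⟨⟨AlgEquiv.refl, e.toRingEquiv, e.commutes, he⟩, rfl⟩

/-- A chosen isomorphism, in the groupoid `BG(k̄)`, of the geometric point below `p` with `x̄`. (Another
choice changes `Torsor.galoisHom` by an inner automorphism, and `specialise` not at all.) -/
noncomputable def Torsor.geometricFibreIso :
    BG.Iso p.geometricFibre (geometricPoint k G) :=
  p.exists_iso_geometricPoint.choose

theorem Torsor.geometricFibreIso_base : p.geometricFibreIso.base = AlgEquiv.refl :=
  p.exists_iso_geometricPoint.choose_spec

theorem isLocallyConstant_galois (x : AlgebraicClosure k) :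
    IsLocallyConstant fun σ : Gal(AlgebraicClosure k/k) => σ x := by
  rw [IsLocallyConstant.iff_exists_open]
  intro σ
  refine ⟨(fun τ => σ⁻¹ * τ) ⁻¹' (MulAction.stabilizer Gal(AlgebraicClosure k/k) x : Set _),
    (stabilizer_isOpen_of_isIntegral x).preimage (continuous_const_mul _), ?_, fun τ hτ => ?_⟩
  · simp
  · have h : σ⁻¹ (τ x) = x := hτ
    calc τ x = σ (σ⁻¹ (τ x)) := (AlgEquiv.apply_symm_apply σ (τ x)).symm
      _ = σ x := by rw [h]

/-- `σ ⊗ 1` on `k̄ ⊗ B`. -/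
noncomputable def Torsor.galoisTotal (σ : Gal(AlgebraicClosure k/k)) :
    BaseChange k (AlgebraicClosure k) p.B ≃+* BaseChange k (AlgebraicClosure k) p.B :=
  (Algebra.TensorProduct.congr σ (AlgEquiv.refl (R := k) (A₁ := p.B))).toRingEquiv

theorem Torsor.galoisTotal_tmul (σ : Gal(AlgebraicClosure k/k)) (x : AlgebraicClosure k)
    (b : p.B) : p.galoisTotal σ (.tmul k _ p.B x b) = .tmul k _ p.B (σ x) b :=
  rfl

/-- The Galois group acts on `Spec k̄ → Spec k → BG` through its action on `Spec k̄`. -/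
noncomputable def Torsor.galoisAction :
    Gal(AlgebraicClosure k/k) →ₜ* BG.Aut p.geometricFibre where
  toFun σ :=
    { base := σ
      total := p.galoisTotal σ
      total_algebraMap := fun r => p.galoisTotal_tmul σ r 1
      total_smul := fun g z => by
        induction z using BaseChange.induction with
        | zero => rw [smul_zero, map_zero, smul_zero]
        | tmul x b =>
          rw [BaseChange.smul_tmul, galoisTotal_tmul, galoisTotal_tmul, BaseChange.smul_tmul]
        | add x y hx hy => rw [smul_add, map_add, map_add, smul_add, hx, hy] }
  map_one' := by
    refine BG.Iso.ext rfl (RingEquiv.ext fun z => ?_)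
    change p.galoisTotal 1 z = z
    induction z using BaseChange.induction with
    | zero => rw [map_zero]
    | tmul x b => rw [galoisTotal_tmul, AlgEquiv.one_apply]
    | add x y hx hy => rw [map_add, hx, hy]
  map_mul' σ τ := by
    refine BG.Iso.ext rfl (RingEquiv.ext fun z => ?_)
    change p.galoisTotal (σ * τ) z = p.galoisTotal σ (p.galoisTotal τ z)
    induction z using BaseChange.induction with
    | zero => simp only [map_zero]
    | tmul x b => simp only [galoisTotal_tmul, AlgEquiv.mul_apply]
    | add x y hx hy => simp only [map_add, hx, hy]
  continuous_toFun := by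
    refine BG.continuous_aut isLocallyConstant_galois fun z => ?_
    change IsLocallyConstant fun σ => p.galoisTotal σ z
    induction z using BaseChange.induction with
    | zero =>
      simp only [map_zero]
      exact IsLocallyConstant.const _
    | tmul x b => exact (isLocallyConstant_galois x).comp fun y => BaseChange.tmul k _ p.B y b
    | add x y hx hy => simpa only [map_add] using hx.comp₂ hy (· + ·)

/-- The homomorphism `Gal(k̄/k) → Aut x̄` induced by the point `p : Spec k → BG`. -/
noncomputable def Torsor.galoisHom :
    Gal(AlgebraicClosure k/k) →ₜ* BG.Aut (geometricPoint k G) :=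
  (BG.Iso.conj p.geometricFibreIso).comp p.galoisAction

theorem Torsor.galoisHom_base (σ : Gal(AlgebraicClosure k/k)) :
    (p.galoisHom σ).base = σ := by
  change (p.geometricFibreIso.base.symm.trans σ).trans p.geometricFibreIso.base = σ
  rw [geometricFibreIso_base]
  rfl

variable (k) in
/-- The Galois module `k̄ˣ`. -/
noncomputable abbrev fieldGm : DiscreteModule.{uk, uk} Gal(AlgebraicClosure k/k) where
  carrier := Additive (AlgebraicClosure k)ˣ
  action :=
    { toFun := fun σ => MonoidHom.toAdditive
        (Units.map (σ : AlgebraicClosure k →* AlgebraicClosure k))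
      map_one' := rfl
      map_mul' := fun _ _ => rfl }
  isLocallyConstant u :=
    IsLocallyConstant.desc _
      (fun v : Additive (AlgebraicClosure k)ˣ => (v.toMul : AlgebraicClosure k))
      (isLocallyConstant_galois (u.toMul : AlgebraicClosure k))
      fun _ _ h => Units.ext h

variable (k) in
/-- The Brauer group `Br k = H²(k, 𝔾ₘ) = H²(Gal(k̄/k), k̄ˣ)`, for `k` perfect. -/
abbrev Br : Type uk := H2 (fieldGm k)

variable (k G) in
/-- The Brauer group `Br(BG) = H²(BG, 𝔾ₘ)`. -/
abbrev BrBG : Type (max uk uG) := H2 (BG.Gm (geometricPoint k G))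

/-- Specialisation `p* : Br(BG) → Br k` of Brauer classes at a `k`-point `p : Spec k → BG`. -/
noncomputable def specialise : BrBG k G →+ Br k :=
  H2.map p.galoisHom (AddMonoidHom.id (Additive (AlgebraicClosure k)ˣ)) fun σ u => by
    refine Additive.toMul.injective (Units.ext ?_)
    exact DFunLike.congr_fun (p.galoisHom_base σ)
      ((Additive.toMul (α := (AlgebraicClosure k)ˣ) u : (AlgebraicClosure k)ˣ) :
        AlgebraicClosure k)

end Specialisation

section Symbol

/-- The group `ℤ/2ℤ`. -/
abbrev C2 : Type := Multiplicative (ZMod 2)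

variable {k : Type uk} [Field k]

/-- The pairing `μ₂ × ℤ/2ℤ → μ₂`, `(ζ, n) ↦ ζⁿ`. -/
noncomputable def muPairing (R : Type uR) [CommRing R] :
    Additive (rootsOfUnity 2 R) →+ Additive C2 →+ Additive (rootsOfUnity 2 R) :=
  AddMonoidHom.mk' (fun ζ => (ZMod.lift 2 ⟨zmultiplesHom _ ζ, by
      have h : ζ.toMul ^ 2 = 1 := Subtype.ext ζ.toMul.2
      rw [zmultiplesHom_apply, natCast_zsmul]
      exact congrArg Additive.ofMul h⟩).comp
        (AddEquiv.additiveMultiplicative (ZMod 2)).toAddMonoidHom) (by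
    intro ζ ξ
    refine AddMonoidHom.ext fun n => ?_
    obtain ⟨m, hm⟩ := ZMod.intCast_surjective (AddEquiv.additiveMultiplicative (ZMod 2) n)
    simp [← hm])

theorem muPairing_apply (R : Type uR) [CommRing R] (ζ : Additive (rootsOfUnity 2 R)) (m : ℤ) :
    muPairing R ζ (Additive.ofMul (Multiplicative.ofAdd (m : ZMod 2))) = m • ζ := by
  simp [muPairing]

theorem muPairing_action (s : BG.Aut (geometricPoint k C2))
    (ζ : (BG.mu (geometricPoint k C2) 2).carrier)
    (n : (BG.const (geometricPoint k C2) (Additive C2)).carrier) :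
    muPairing (AlgebraicClosure k) ((BG.mu (geometricPoint k C2) 2).action s ζ)
        ((BG.const (geometricPoint k C2) (Additive C2)).action s n) =
      (BG.mu (geometricPoint k C2) 2).action s (muPairing (AlgebraicClosure k) ζ n) := by
  obtain ⟨m, hm⟩ := ZMod.intCast_surjective (show ZMod 2 from n)
  obtain rfl : Additive.ofMul (Multiplicative.ofAdd (m : ZMod 2)) = n := hm
  change muPairing (AlgebraicClosure k) ((BG.mu (geometricPoint k C2) 2).action s ζ)
    (Additive.ofMul (Multiplicative.ofAdd (m : ZMod 2))) = _
  rw [muPairing_apply, muPairing_apply, map_zsmul]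

/-- The class `(a, [π]) ∈ Br(Bℤ/2ℤ)` of `a ∈ kˣ`: the image under `H²(Bℤ/2ℤ, μ₂) → H²(Bℤ/2ℤ, 𝔾ₘ)` of
the cup product `a ∪ [π]` of `a ∈ H¹(Bℤ/2ℤ, μ₂)` and `[π] ∈ H¹(Bℤ/2ℤ, ℤ/2ℤ)`. -/
noncomputable def symbol (a : kˣ) : BrBG k C2 :=
  H2.map (ContinuousMonoidHom.id _) (BG.muToGm (geometricPoint k C2) 2)
    (BG.muToGm_action (geometricPoint k C2) 2)
    (H1.cup (A := BG.mu (geometricPoint k C2) 2)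
      (B := BG.const (geometricPoint k C2) (Additive C2))
      (C := BG.mu (geometricPoint k C2) 2)
      (muPairing (AlgebraicClosure k)) muPairing_action
      (kummerClass C2 2 a) (universalTorsorClass k C2))

end Symbol

section QuadraticPoint

/-- The `G`-torsor `Spec K → Spec k` of a finite Galois extension `K/k` with group `G`. -/
noncomputable def galoisTorsor {G : Type uG} [Group G] {k : Type uk} [Field k] (K : Type uB)
    [Field K] [Algebra k K] [FiniteDimensional k K] [IsGalois k K] (e : G ≃* Gal(K/k)) :
    Torsor.{uG, uk, uB} G k :=
  letI : MulSemiringAction G K := MulSemiringAction.compHom K e.toMonoidHom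
  haveI : SMulCommClass G k K := ⟨fun g r x => map_smul (e g) r x⟩
  { B := K
    isTorsor := isTorsor_of_isGalois G k K (by
      have h : (MulSemiringAction.toAlgEquiv k K : G → K ≃ₐ[k] K) = e :=
        funext fun g => AlgEquiv.ext fun x => rfl
      rw [h]
      exact e.bijective) }

variable (K : Type uB) [Field K] [NumberField K] [Algebra.IsQuadraticExtension ℚ K]

/-- The (unique) isomorphism of `ℤ/2ℤ` with the Galois group of a quadratic field. -/
noncomputable def quadraticGalEquiv : C2 ≃* Gal(K/ℚ) :=
  mulEquivOfPrimeCardEq (p := 2) (by simp) (by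
    rw [IsGalois.card_aut_eq_finrank, Algebra.IsQuadraticExtension.finrank_eq_two])

/-- The point of `Bℤ/2ℤ` over `ℚ` that corresponds to the quadratic field `K`: the torsor
`Spec K → Spec ℚ`. -/
noncomputable def quadraticPoint : Torsor.{0, 0, uB} C2 ℚ :=
  galoisTorsor K (quadraticGalEquiv K)

end QuadraticPoint

end ClassifyingStack

/-!
The class `(-1, [π])` is specialised by pulling a cocycle back along `Gal(ℚ̄/ℚ) → Aut x̄`. For a
`ℤ/2ℤ`-torsor `p` over a field `k` of characteristic zero and `a = α²` in `kˣ`, the result is the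
cocycle `(s, t) ↦ (s α / α) ^ χ(t)`, where the character `χ` is the monodromy of `p`
(`specialise_symbol_eq_zero_iff_exists_cochain`). If the coordinate ring of `p` contains a square
root of `d` on which `ℤ/2ℤ` acts by the sign, then `χ` is the quadratic character of `d`, since the
fibre of `p` over `k̄` gives an algebra map `p.B → k̄` that intertwines the Galois action with the
monodromy (`Torsor.exists_algHom_monodromy`).

For `a` not a square, this cocycle is a coboundary exactly when `d = x² - a y²` is a norm from
`k(α)` (`exists_cochain_iff`). A cochain bounding it is a cocycle on the stabiliser of `α`, so by
Hilbert's Theorem 90 it can be normalised to be trivial there; its value at an `r` with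
`r α = -α`, divided by `√d`, is then an element of `k(α)` of norm `1 / d`. The same formula, read
backwards, turns an element of norm `d` into a bounding cochain.

For a quadratic field the discriminant is the square of `b₀ σ(b₁) - b₁ σ(b₀)`, which `σ` negates
(`NumberField.exists_sq_eq_discr`), so `d` can be taken to be the discriminant. With `a = -1` the
condition says that the discriminant is a sum of two rational squares, and for an integer this is
the same as being a sum of two integer squares (`Int.exists_eq_sq_add_sq_of_rat`).
-/

/-! ### Hilbert's Theorem 90 for profinite Galois groups -/

/-- **Hilbert's Theorem 90** for a subgroup `H` of the (possibly infinite) automorphism group: a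
cocycle that is trivial near `1` has the form `s ↦ b / s b`. Triviality near `1` makes `c s` depend
only on the restriction of `s` to a finite extension `E`, so that `b` can be found as a Poincaré
series over the finitely many restrictions to `E` of elements of `H`. -/
theorem exists_ne_zero_mul_apply_eq_of_cocycle {k L : Type*} [Field k] [Field L] [Algebra k L]
    (H : Subgroup Gal(L/k)) (c : Gal(L/k) → L) (hc0 : ∀ s ∈ H, c s ≠ 0)
    (hc : ∀ s ∈ H, ∀ t ∈ H, c (s * t) = c s * s (c t))
    (h1 : ∀ᶠ s in nhds (1 : Gal(L/k)), c s = 1) :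
    ∃ b : L, b ≠ 0 ∧ ∀ s ∈ H, c s * s b = b := by
  classical
  obtain ⟨E, hE, hEc⟩ := (krullTopology_mem_nhds_one_iff k L _).1 h1
  -- `c s` depends only on the restriction of `s` to the finite extension `E`
  have hdep : ∀ s ∈ H, ∀ t ∈ H,
      (s : L →ₐ[k] L).comp E.val = (t : L →ₐ[k] L).comp E.val → c s = c t := by
    intro s hs t ht hst
    have hmem : s⁻¹ * t ∈ E.fixingSubgroup := by
      rw [IntermediateField.mem_fixingSubgroup_iff]
      intro x hx
      have : s x = t x := DFunLike.congr_fun hst (⟨x, hx⟩ : E)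
      rw [AlgEquiv.mul_apply, ← this]
      exact s.symm_apply_apply x
    have h := hc s hs (s⁻¹ * t) (H.mul_mem (H.inv_mem hs) ht)
    rw [mul_inv_cancel_left, show c (s⁻¹ * t) = 1 from hEc hmem, map_one, mul_one] at h
    exact h.symm
  let S : Type _ := {φ : E →ₐ[k] L // ∃ s ∈ H, (s : L →ₐ[k] L).comp E.val = φ}
  have : Fintype S := Fintype.ofFinite S
  choose r hrH hr using fun φ : S => φ.2
  let toS (s : Gal(L/k)) (hs : s ∈ H) : S := ⟨_, s, hs, rfl⟩
  -- Dedekind's independence of characters gives a nonzero value of the Poincaré series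
  obtain ⟨x, hx⟩ : ∃ x : E, ∑ φ : S, c (r φ) * φ.1 x ≠ 0 := by
    by_contra! h
    have hli : LinearIndependent L fun φ : S => φ.1.toLinearMap :=
      (linearIndependent_toLinearMap k E L).comp (fun φ : S => φ.1) Subtype.val_injective
    refine hc0 _ (hrH (toS 1 H.one_mem)) (Fintype.linearIndependent_iff.1 hli
      (fun φ => c (r φ)) (LinearMap.ext fun x => ?_) (toS 1 H.one_mem))
    simpa using h x
  refine ⟨_, hx, fun s hs => ?_⟩
  -- multiplication by `s` permutes the restrictions
  rw [map_sum, Finset.mul_sum]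
  refine Fintype.sum_equiv
    { toFun := fun φ => toS (s * r φ) (H.mul_mem hs (hrH φ))
      invFun := fun φ => toS (s⁻¹ * r φ) (H.mul_mem (H.inv_mem hs) (hrH φ))
      left_inv := ?_
      right_inv := ?_ } _ _ fun φ => ?_
  · intro φ
    refine Subtype.ext (AlgHom.ext fun y => ?_)
    have h := DFunLike.congr_fun (hr (toS (s * r φ) (H.mul_mem hs (hrH φ)))) y
    change s⁻¹ (r _ y) = _
    change r _ y = s (r φ y) at h
    rw [h, ← hr φ]
    exact s.symm_apply_apply _
  · intro φ
    refine Subtype.ext (AlgHom.ext fun y => ?_)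
    have h := DFunLike.congr_fun (hr (toS (s⁻¹ * r φ) (H.mul_mem (H.inv_mem hs) (hrH φ)))) y
    change s (r _ y) = _
    change r _ y = s⁻¹ (r φ y) at h
    rw [h, ← hr φ]
    exact s.apply_symm_apply _
  · have h := hr (toS (s * r φ) (H.mul_mem hs (hrH φ)))
    have h2 := hdep _ (hrH (toS (s * r φ) (H.mul_mem hs (hrH φ)))) _ (H.mul_mem hs (hrH φ)) h
    change c s * s (c (r φ) * φ.1 x) = c (r (toS (s * r φ) (H.mul_mem hs (hrH φ)))) *
      (toS (s * r φ) (H.mul_mem hs (hrH φ))).1 x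
    rw [h2, hc s hs _ (hrH φ), map_mul, mul_assoc]
    congr 2
    exact congrArg s (DFunLike.congr_fun (hr φ) x).symm

/-! ### Quaternion cocycles and norms -/

/-- If `z` lies in `k(α)`, with `α² = a` and `r` the conjugation `α ↦ -α`, then its norm `z * r z`
has the form `x² - a y²`. That `z` lies in `k(α)` is expressed by its being fixed by the stabiliser
of `α`; then `x = (z + r z) / 2` and `y = (z - r z) / (2 α)` are fixed by the whole group. -/
theorem exists_mul_eq_sq_sub_of_fixed {k L : Type*} [Field k] [CharZero k] [Field L] [Algebra k L]
    [IsGalois k L] {a : k} {α : L} (hα : α ^ 2 = algebraMap k L a) (hα0 : α ≠ 0)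
    {r : Gal(L/k)} (hr : r α = -α) {z : L} (hz : ∀ s : Gal(L/k), s α = α → s z = z) :
    ∃ x y : k, z * r z = algebraMap k L (x ^ 2 - a * y ^ 2) := by
  have : CharZero L := charZero_of_injective_algebraMap (algebraMap k L).injective
  have hsign : ∀ s : Gal(L/k), s α = α ∨ s α = -α := fun s => by
    rw [← sq_eq_sq_iff_eq_or_eq_neg, ← map_pow, hα, AlgEquiv.commutes]
  have hrr : r (r z) = z := hz (r * r) (by simp [hr])
  have hconj : ∀ s : Gal(L/k), s α = -α → s z = r z := fun s hs => by
    have h := hz (r * s) (by simp [hs, hr])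
    rw [AlgEquiv.mul_apply] at h
    exact r.injective (h.trans hrr.symm)
  have hconj' : ∀ s : Gal(L/k), s α = -α → s (r z) = z :=
    fun s hs => hz (s * r) (by simp [hs, hr])
  have hfix : ∀ s : Gal(L/k), s α = α → s (r z) = r z := fun s hs =>
    hconj (s * r) (by simp [hs, hr])
  obtain ⟨x, hx⟩ := (InfiniteGalois.mem_range_algebraMap_iff_fixed (k := k)
    ((z + r z) / 2)).2 fun s => by
      rcases hsign s with h | h
      · simp [hz s h, hfix s h, map_ofNat s 2]
      · simp [hconj s h, hconj' s h, add_comm, map_ofNat s 2]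
  obtain ⟨y, hy⟩ := (InfiniteGalois.mem_range_algebraMap_iff_fixed (k := k)
    ((z - r z) / (2 * α))).2 fun s => by
      rcases hsign s with h | h
      · simp [hz s h, hfix s h, h, map_ofNat s 2]
      · simp only [map_div₀, map_sub, map_mul, hconj s h, hconj' s h, h, map_ofNat]
        rw [mul_neg, div_neg, ← neg_div, neg_sub]
  refine ⟨x, y, ?_⟩
  rw [map_sub, map_mul, map_pow, map_pow, hx, hy, ← hα]
  field_simp
  ring

/-- The cocycle `(s, t) ↦ (s α / α) ^ χ(t)`, where `χ` is the quadratic character of `d = δ²`, is a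
coboundary if and only if `d` is a norm from `k(α)`, where `α² = a`. The exponent `χ(t)` is encoded
by the case distinction `t δ = δ`. -/
theorem exists_cochain_iff {k L : Type*} [Field k] [CharZero k] [Field L] [Algebra k L]
    [IsGalois k L] {a d : k} (ha : ¬ IsSquare a) (hd : d ≠ 0) {α δ : L}
    (hα : α ^ 2 = algebraMap k L a) (hδ : δ ^ 2 = algebraMap k L d)
    [∀ t : Gal(L/k), Decidable (t δ = δ)]
    (hloc : ∀ x : L, IsLocallyConstant fun s : Gal(L/k) => s x) :
    (∃ c : LocallyConstant Gal(L/k) Lˣ, ∀ s t : Gal(L/k),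
      (if t δ = δ then 1 else s α / α) * (c (s * t) : L) = s (c t) * c s) ↔
      ∃ x y : k, d = x ^ 2 - a * y ^ 2 := by
  have : CharZero L := charZero_of_injective_algebraMap (algebraMap k L).injective
  have hα0 : α ≠ 0 := by
    rintro rfl
    refine ha ⟨0, ?_⟩
    rw [zero_pow two_ne_zero, eq_comm, map_eq_zero] at hα
    rw [hα, mul_zero]
  have hδ0 : δ ≠ 0 := by
    rintro rfl
    rw [zero_pow two_ne_zero, eq_comm, map_eq_zero] at hδ
    exact hd hδ
  have hneg : ∀ x : L, x ≠ 0 → -x ≠ x := fun x hx h => hx (neg_eq_self.1 h)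
  have hsα : ∀ s : Gal(L/k), s α = α ∨ s α = -α := fun s => by
    rw [← sq_eq_sq_iff_eq_or_eq_neg, ← map_pow, hα, AlgEquiv.commutes]
  have hsδ : ∀ s : Gal(L/k), s δ = δ ∨ s δ = -δ := fun s => by
    rw [← sq_eq_sq_iff_eq_or_eq_neg, ← map_pow, hδ, AlgEquiv.commutes]
  -- the cocycle is trivial where `s` fixes `α`, and is the character of `δ` elsewhere
  have hf1 : ∀ s t : Gal(L/k), s α = α → (if t δ = δ then 1 else s α / α) = 1 := fun s t h => by
    rw [h, div_self hα0, ite_self]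
  have hf2 : ∀ s t : Gal(L/k), s α = -α → (if t δ = δ then 1 else s α / α) = t δ / δ :=
    fun s t h => by
      rw [h, neg_div, div_self hα0]
      rcases hsδ t with h | h
      · rw [if_pos h, h, div_self hδ0]
      · rw [if_neg (h ▸ hneg δ hδ0), h, neg_div, div_self hδ0]
  obtain ⟨r, hr⟩ : ∃ r : Gal(L/k), r α = -α := by
    by_contra! h
    obtain ⟨y, hy⟩ := (InfiniteGalois.mem_range_algebraMap_iff_fixed (k := k) α).2
      fun s => (hsα s).resolve_right (h s)
    refine ha ⟨y, (algebraMap k L).injective ?_⟩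
    rw [← hα, map_mul, hy, sq]
  constructor
  · rintro ⟨c, hc⟩
    have hc1 : (c 1 : L) = 1 := by
      have h := hc 1 1
      rw [hf1 1 1 rfl, one_mul, mul_one, AlgEquiv.one_apply] at h
      exact (mul_eq_left₀ (c 1).ne_zero).1 h.symm
    obtain ⟨b, hb0, hb⟩ := exists_ne_zero_mul_apply_eq_of_cocycle (MulAction.stabilizer Gal(L/k) α)
      (fun s => (c s : L)) (fun s _ => (c s).ne_zero)
      (fun s hs t _ => by
        have h := hc s t
        rw [hf1 s t hs, one_mul, mul_comm] at h
        exact h)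
      (by
        filter_upwards [c.isLocallyConstant.eventually_eq 1] with s hs
        exact (congrArg Units.val hs).trans hc1)
    -- normalise the cochain to be trivial on the stabiliser of `α`
    let g (s : Gal(L/k)) : L := c s * s b / b
    have hg1 : ∀ s : Gal(L/k), s α = α → g s = 1 := fun s hs => by
      change c s * s b / b = 1
      rw [hb s hs, div_self hb0]
    have hg : ∀ s t : Gal(L/k),
        (if t δ = δ then 1 else s α / α) * g (s * t) = s (g t) * g s := fun s t => by
      have hsb : s b ≠ 0 := (map_ne_zero s).2 hb0
      simp only [g, map_div₀, map_mul, AlgEquiv.mul_apply]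
      rw [← mul_div_assoc, ← mul_assoc, hc s t]
      field_simp
    -- `s * r = r * (r⁻¹ * s * r)` gives two expressions for `g (s * r)`, and `s` acts on `g r` by
    -- the character of `δ`
    have hfix : ∀ s : Gal(L/k), s α = α → s (g r / δ) = g r / δ := fun s hs => by
      have ht : (r⁻¹ * s * r) α = α := by
        simp only [AlgEquiv.mul_apply, hr, map_neg, hs]
        rw [← map_neg, ← hr]
        exact r.symm_apply_apply α
      have h1 := hg s r
      have h2 := hg r (r⁻¹ * s * r)
      rw [hf1 _ _ hs, one_mul, hg1 s hs, mul_one] at h1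
      rw [hf2 _ _ hr, hg1 _ ht, map_one, one_mul,
        show r * (r⁻¹ * s * r) = s * r by group, h1] at h2
      have h3 : (r⁻¹ * s * r) δ = s δ := by
        have h4 : r ((r⁻¹ * s * r) δ) = s (r δ) := by
          rw [← AlgEquiv.mul_apply, ← AlgEquiv.mul_apply]
          congr 1
          group
        rcases hsδ (r⁻¹ * s * r) with h | h <;> rcases hsδ r with h' | h' <;>
          simpa [h, h', neg_eq_iff_eq_neg, eq_comm] using h4
      rw [h3] at h2
      have hsδ0 : s δ ≠ 0 := (map_ne_zero s).2 hδ0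
      rw [map_div₀, div_eq_div_iff hsδ0 hδ0]
      rcases hsδ s with h | h
      · rw [h, div_self hδ0, one_mul] at h2
        rw [h2, h]
      · rw [h, neg_div, div_self hδ0, neg_one_mul] at h2
        rw [h]
        linear_combination (-δ) * h2
    obtain ⟨x, y, hxy⟩ := exists_mul_eq_sq_sub_of_fixed hα hα0 hr hfix
    have h1 := hg r r
    rw [hf2 _ _ hr, hg1 (r * r) (by simp [hr]), mul_one] at h1
    have hrδ0 : r δ ≠ 0 := (map_ne_zero r).2 hδ0
    have h2 : d * (x ^ 2 - a * y ^ 2) = 1 := by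
      refine (algebraMap k L).injective ?_
      rw [map_mul, ← hxy, map_one, ← hδ, map_div₀]
      calc δ ^ 2 * (g r / δ * (r (g r) / r δ)) = (r (g r) * g r) * (δ / r δ) := by field_simp
        _ = 1 := by rw [← h1]; field_simp
    exact ⟨d * x, d * y, by linear_combination (-d) * h2⟩
  · rintro ⟨x, y, hxy⟩
    let z : L := algebraMap k L x + algebraMap k L y * α
    have hN : ∀ s : Gal(L/k), s α = -α → z * s z = δ ^ 2 := fun s hs => by
      simp only [z, map_add, map_mul, AlgEquiv.commutes, hs]
      rw [hδ, hxy, map_sub, map_mul, map_pow, map_pow, ← hα]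
      ring
    have hz : ∀ s : Gal(L/k), s α = α → s z = z := fun s hs => by
      simp only [z, map_add, map_mul, AlgEquiv.commutes, hs]
    have hz0 : z ≠ 0 := fun h => pow_ne_zero 2 hδ0 (by rw [← hN r hr, h, zero_mul])
    classical
    -- the cochain is `1` on the stabiliser of `α` and `s δ / z` elsewhere, written as a function of
    -- `s α` and `s δ` so that it is visibly locally constant
    let g (u v : L) : Lˣ := if u = α then 1 else if hv : v = 0 then 1 else Units.mk0 (v / z)
      (div_ne_zero hv hz0)
    let c : LocallyConstant Gal(L/k) Lˣ :=
      ⟨fun s => g (s α) (s δ), (hloc α).comp₂ (hloc δ) g⟩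
    have hcα : ∀ s : Gal(L/k), s α = α → (c s : L) = 1 := fun s hs => by
      change (g (s α) (s δ) : L) = 1
      rw [hs]
      simp [g]
    have hcα' : ∀ s : Gal(L/k), s α = -α → (c s : L) = s δ / z := fun s hs => by
      change (g (s α) (s δ) : L) = _
      rw [hs]
      simp [g, hneg α hα0, hδ0]
    refine ⟨c, fun s t => ?_⟩
    rcases hsα s with hs | hs <;> rcases hsα t with ht | ht
    · rw [hf1 s t hs, hcα s hs, hcα t ht, hcα (s * t) (by simp [hs, ht]), map_one]
    · rw [hf1 s t hs, hcα s hs, hcα' t ht, hcα' (s * t) (by simp [hs, ht]), map_div₀, hz s hs,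
        one_mul, mul_one, AlgEquiv.mul_apply]
    · rw [hf2 s t hs, hcα' s hs, hcα t ht, hcα' (s * t) (by simp [hs, ht]), map_one, one_mul,
        AlgEquiv.mul_apply]
      rcases hsδ t with h | h
      · rw [h, div_self hδ0, one_mul]
      · rw [h, neg_div, div_self hδ0, map_neg, neg_div, neg_one_mul, neg_neg]
    · rw [hf2 s t hs, hcα' s hs, hcα' t ht, hcα (s * t) (by simp [hs, ht]), mul_one, map_div₀]
      have hsz : s z ≠ 0 := (map_ne_zero s).2 hz0
      have h := hN s hs
      rcases hsδ t with h1 | h1 <;> rcases hsδ s with h2 | h2 <;> rw [h1] <;>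
        simp only [map_neg, h2] <;> field_simp <;>
        first | linear_combination h | linear_combination -h

/-! ### Specialisation of symbols on the classifying stack -/

namespace ClassifyingStack

open ContCohomology

universe uk uG uB

/-- A torsor has a `k̄`-valued point `j`, the point `1` of the trivialised geometric fibre, on which
the Galois group acts through the inverse of the monodromy. -/
theorem Torsor.exists_algHom_monodromy {k : Type uk} [Field k] {G : Type uG} [Group G] [Finite G]
    (p : Torsor.{uG, uk, uB} G k) :
    ∃ j : p.B →ₐ[k] AlgebraicClosure k, ∀ (s : Gal(AlgebraicClosure k/k)) (b : p.B),
      s (j (monodromy (p.galoisHom s) • b)) = j b := by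
  let e := p.geometricFibreIso
  have hbase (x : AlgebraicClosure k) : e.base x = x :=
    DFunLike.congr_fun p.geometricFibreIso_base x
  let ι : p.B →+* BaseChange k (AlgebraicClosure k) p.B :=
    (Algebra.TensorProduct.includeRight :
      p.B →ₐ[k] TensorProduct k (AlgebraicClosure k) p.B).toRingHom
  have hι (b : p.B) : ι b = BaseChange.tmul k (AlgebraicClosure k) p.B 1 b := rfl
  let ev (c : G) : Trivial G (AlgebraicClosure k) →ₐ[AlgebraicClosure k] AlgebraicClosure k :=
    Trivial.eval (AlgebraicClosure k) c
  refine ⟨{ toRingHom := (ev 1).toRingHom.comp (e.total.toRingHom.comp ι)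
            commutes' := fun r => ?_ }, fun s b => ?_⟩
  · have h1 : ι (algebraMap k p.B r) = algebraMap (AlgebraicClosure k)
        (BaseChange k (AlgebraicClosure k) p.B) (algebraMap k (AlgebraicClosure k) r) :=
      (Algebra.TensorProduct.tmul_one_eq_one_tmul r).symm
    change ev 1 (e.total (ι (algebraMap k p.B r))) = _
    rw [h1]
    refine (congrArg (ev 1) (e.total_algebraMap _)).trans ?_
    exact ((ev 1).commutes _).trans (hbase _)
  · change s (ev 1 (e.total (ι (monodromy (p.galoisHom s) • b)))) = ev 1 (e.total (ι b))
    have h := monodromy_spec (p.galoisHom s) (e.total (ι b))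
    have h1 : (p.galoisHom s).total (e.total (ι b)) = e.total (ι b) := by
      change e.total (p.galoisTotal s (e.total.symm (e.total (ι b)))) = _
      rw [RingEquiv.symm_apply_apply, hι, galoisTotal_tmul, map_one]
    have h2 : e.total (ι (monodromy (p.galoisHom s) • b)) =
        monodromy (p.galoisHom s) • e.total (ι b) := by
      rw [← e.total_smul, hι, hι]
      exact congrArg e.total (BaseChange.smul_tmul _ _ _ _ _ _ _).symm
    rw [h1, p.galoisHom_base] at h
    rw [h, h2]
    exact congrArg s ((Trivial.eval_smul _ _ _ _).trans (by rw [one_mul]))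

theorem muPairing_ofMul {R : Type*} [CommRing R] (ζ : Additive (rootsOfUnity 2 R)) (g : C2) :
    muPairing R ζ (Additive.ofMul g) = if g = 1 then 0 else ζ := by
  obtain ⟨n, rfl⟩ := Multiplicative.ofAdd.surjective g
  fin_cases n
  · have := muPairing_apply R ζ 0
    rw [Int.cast_zero, zero_smul] at this
    exact this
  · have := muPairing_apply R ζ 1
    rw [Int.cast_one, one_smul] at this
    exact this

/-- The specialisation of `(a, [π])` at `p` is the class of the cocycle `(s, t) ↦ (s α / α) ^ χ(t)`,
where `χ` is the monodromy of `p` and `α` is any square root of `a`. -/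
theorem specialise_symbol_eq_zero_iff_exists_cochain {k : Type uk} [Field k]
    (p : Torsor.{0, uk, uB} C2 k) (a : kˣ) {α : AlgebraicClosure k} (hα : α ^ 2 = algebraMap k (AlgebraicClosure k) a) :
    specialise p (symbol a) = 0 ↔
      ∃ c : LocallyConstant Gal(AlgebraicClosure k/k) (AlgebraicClosure k)ˣ,
        ∀ s t : Gal(AlgebraicClosure k/k),
          (if monodromy (p.galoisHom t) = 1 then 1 else s α / α) *
            (c (s * t) : AlgebraicClosure k) = s (c t) * c s := by
  let b : (AlgebraicClosure k)ˣ := (exists_unit_root 2 a).choose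
  have hb : (b : AlgebraicClosure k) ^ 2 = algebraMap k (AlgebraicClosure k) a := by
    have := congrArg Units.val (exists_unit_root 2 a).choose_spec
    simpa using this
  -- `α` agrees up to sign with the square root in the definition of the Kummer class
  have hbα (s : Gal(AlgebraicClosure k/k)) : s b / b = s α / α := by
    rcases sq_eq_sq_iff_eq_or_eq_neg.1 (hb.trans hα.symm) with h | h
    · rw [h]
    · rw [h, map_neg, neg_div_neg_eq]
  refine (QuotientAddGroup.eq_zero_iff _).trans ?_
  change (∃ c : LocallyConstant Gal(AlgebraicClosure k/k) (Additive (AlgebraicClosure k)ˣ),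
    ∀ s t, _) ↔ _
  refine exists_congr fun c => forall₂_congr fun s t => ?_
  have hs (x : AlgebraicClosure k) : (p.galoisHom s).base x = s x := by rw [p.galoisHom_base]
  let σ : (AlgebraicClosure k)ˣ →* (AlgebraicClosure k)ˣ :=
    Units.map ((p.galoisHom s).base : AlgebraicClosure k →* AlgebraicClosure k)
  have hζ : σ b / b ∈ rootsOfUnity 2 (AlgebraicClosure k) := by
    rw [mem_rootsOfUnity, div_pow, div_eq_one, ← map_pow]
    refine Units.ext ?_
    change (p.galoisHom s).base ((b ^ 2 : (AlgebraicClosure k)ˣ) : AlgebraicClosure k) = _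
    rw [Units.val_pow_eq_pow_val, hb, AlgEquiv.commutes]
  change BG.muToGm (geometricPoint k C2) 2 (muPairing (AlgebraicClosure k)
      (Additive.ofMul ⟨σ b / b, hζ⟩) (Additive.ofMul (monodromy (p.galoisHom t)))) =
    (fieldGm k).action s (c t) - c (s * t) + c s ↔ _
  rw [muPairing_ofMul, sub_add_eq_add_sub, eq_sub_iff_add_eq, ← Additive.toMul.injective.eq_iff,
    ← Units.val_injective.eq_iff]
  refine Eq.congr ?_ rfl
  refine congrArg (· * ((c (s * t)).toMul : AlgebraicClosure k)) ?_
  split_ifs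
  · rw [map_zero]
    rfl
  · change ((σ b / b : (AlgebraicClosure k)ˣ) : AlgebraicClosure k) = _
    rw [Units.val_div_eq_div_val, ← hbα, ← hs]
    rfl

/-- The class `(a, [π])` vanishes at the torsor defined by `√d` if and only if `d` is a norm from
`k(√a)`, for `a` not a square. -/
theorem specialise_symbol_eq_zero_iff {k : Type uk} [Field k] [CharZero k]
    (p : Torsor.{0, uk, uB} C2 k) {a : kˣ} (ha : ¬ IsSquare (a : k)) {d : k} (hd : d ≠ 0)
    {b : p.B} (hb : b ^ 2 = algebraMap k p.B d)
    (hsmul : (Multiplicative.ofAdd 1 : C2) • b = -b) :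
    specialise p (symbol a) = 0 ↔ ∃ x y : k, d = x ^ 2 - a * y ^ 2 := by
  classical
  obtain ⟨j, hj⟩ := p.exists_algHom_monodromy
  obtain ⟨α, hα⟩ := IsAlgClosed.exists_pow_nat_eq (algebraMap k (AlgebraicClosure k) a) two_pos
  have hδ : j b ^ 2 = algebraMap k (AlgebraicClosure k) d := by
    rw [← map_pow, hb, AlgHom.commutes]
  have : CharZero (AlgebraicClosure k) :=
    charZero_of_injective_algebraMap (algebraMap k (AlgebraicClosure k)).injective
  have hδ0 : j b ≠ 0 := by
    intro h
    rw [h, zero_pow two_ne_zero, eq_comm, map_eq_zero] at hδ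
    exact hd hδ
  have hmon (t : Gal(AlgebraicClosure k/k)) :
      t (j b) = j b ↔ monodromy (p.galoisHom t) = 1 := by
    have h := hj t b
    constructor
    · intro ht
      by_contra hg
      have hg' : monodromy (p.galoisHom t) = Multiplicative.ofAdd 1 :=
        (by decide : ∀ g : C2, g ≠ 1 → g = Multiplicative.ofAdd 1) _ hg
      rw [hg', hsmul, map_neg, map_neg, ht] at h
      exact hδ0 (neg_eq_self.1 h)
    · intro h1
      rwa [h1, one_smul] at h
  rw [specialise_symbol_eq_zero_iff_exists_cochain _ _ hα,
    ← exists_cochain_iff ha hd hα hδ isLocallyConstant_galois]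
  exact exists_congr fun c => forall₂_congr fun s t => by rw [if_congr (hmon t) rfl rfl]

end ClassifyingStack

/-! ### Discriminants and sums of two squares -/

/-- The discriminant of a quadratic field is the square of an element negated by conjugation, namely
of the determinant of the matrix of conjugates of an integral basis. -/
theorem NumberField.exists_sq_eq_discr (K : Type*) [Field K] [NumberField K]
    [Algebra.IsQuadraticExtension ℚ K] {σ : Gal(K/ℚ)} (hσ : σ ≠ 1) :
    ∃ δ : K, δ ^ 2 = NumberField.discr K ∧ σ δ = -δ := by
  classical
  have hfin : Module.finrank ℚ K = 2 := Algebra.IsQuadraticExtension.finrank_eq_two ℚ K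
  have hcard : Nat.card Gal(K/ℚ) = 2 := by rw [IsGalois.card_aut_eq_finrank, hfin]
  have huniv : (Finset.univ : Finset Gal(K/ℚ)) = {1, σ} := by
    symm
    rw [← Finset.card_eq_iff_eq_univ, Finset.card_pair hσ.symm, ← hcard, Nat.card_eq_fintype_card]
  have hσσ (x : K) : σ (σ x) = x := by
    have : σ ^ 2 = 1 := by rw [← hcard]; exact pow_card_eq_one'
    rw [← AlgEquiv.mul_apply, ← sq, this, AlgEquiv.one_apply]
  have htr (x : K) : algebraMap ℚ K (Algebra.trace ℚ K x) = x + σ x := by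
    rw [trace_eq_sum_automorphisms, huniv, Finset.sum_pair hσ.symm, AlgEquiv.one_apply]
  have e : Module.Free.ChooseBasisIndex ℤ (NumberField.RingOfIntegers K) ≃ Fin 2 :=
    Fintype.equivFinOfCardEq (by
      rw [← Module.finrank_eq_card_chooseBasisIndex, NumberField.RingOfIntegers.rank, hfin])
  let b : Module.Basis (Fin 2) ℚ K := (NumberField.integralBasis K).reindex e
  have hdisc : (NumberField.discr K : ℚ) = Algebra.discr ℚ b := by
    rw [NumberField.coe_discr, Module.Basis.coe_reindex, Algebra.discr_reindex]
  refine ⟨b 0 * σ (b 1) - b 1 * σ (b 0), ?_, ?_⟩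
  · have : (NumberField.discr K : K) = algebraMap ℚ K (NumberField.discr K : ℚ) := by simp
    rw [this, hdisc, Algebra.discr_def, Matrix.det_fin_two]
    simp only [Algebra.traceMatrix_apply, Algebra.traceForm_apply, map_sub, map_mul, htr]
    ring
  · rw [map_sub, map_mul, map_mul, hσσ, hσσ]
    ring

/-- An integer that is a sum of two rational squares is a sum of two integer squares: after
clearing denominators, the exponents of the primes `q ≡ 3 mod 4` keep their parity. -/
theorem Int.exists_eq_sq_add_sq_of_rat {n : ℤ} (h : ∃ x y : ℚ, (n : ℚ) = x ^ 2 + y ^ 2) :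
    ∃ a b : ℤ, n = a ^ 2 + b ^ 2 := by
  obtain ⟨x, y, h⟩ := h
  have hn : 0 ≤ n := by
    have : (0 : ℚ) ≤ n := by rw [h]; positivity
    exact_mod_cast this
  lift n to ℕ using hn
  rcases Nat.eq_zero_or_pos n with rfl | hpos
  · exact ⟨0, 0, by simp⟩
  set m := x.den * y.den with hm
  have hm0 : m ≠ 0 := mul_ne_zero x.den_nz y.den_nz
  have key : n * m ^ 2 = (x.num * y.den).natAbs ^ 2 + (y.num * x.den).natAbs ^ 2 := by
    zify
    simp only [sq_abs]
    have hx : (x.den : ℚ) ≠ 0 := by exact_mod_cast x.den_nz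
    have hy : (y.den : ℚ) ≠ 0 := by exact_mod_cast y.den_nz
    have h' : (n : ℚ) = (x.num / x.den) ^ 2 + (y.num / y.den) ^ 2 := by
      rw [Rat.num_div_den, Rat.num_div_den]; exact_mod_cast h
    have : (n : ℚ) * (x.den * y.den) ^ 2 = (x.num * y.den) ^ 2 + (y.num * x.den) ^ 2 := by
      rw [h']; field_simp
    rw [hm]
    exact_mod_cast this
  have hval := Nat.eq_sq_add_sq_iff.1 ⟨_, _, key⟩
  obtain ⟨a, b, hab⟩ : ∃ a b : ℕ, n = a ^ 2 + b ^ 2 := by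
    refine Nat.eq_sq_add_sq_iff.2 fun q hq hq3 => ?_
    have hqp : Fact q.Prime := ⟨Nat.prime_of_mem_primeFactors hq⟩
    have hq' : q ∈ (n * m ^ 2).primeFactors :=
      Nat.primeFactors_mono (Dvd.intro _ rfl) (by positivity) hq
    have h2 := hval q hq' hq3
    rw [padicValNat.mul hpos.ne' (pow_ne_zero _ hm0), padicValNat.pow] at h2
    exact (Nat.even_add.1 h2).2 (even_two_mul _)
  exact ⟨a, b, by exact_mod_cast hab⟩

theorem proposition5p1 (K : Type*) [Field K] [NumberField K] [Algebra.IsQuadraticExtension ℚ K] :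
    (∃ a b : ℤ, NumberField.discr K = a ^ 2 + b ^ 2) ↔
      ClassifyingStack.specialise (ClassifyingStack.quadraticPoint K)
        (ClassifyingStack.symbol (-1 : ℚˣ)) = 0 := by
  have hne : ClassifyingStack.quadraticGalEquiv K (Multiplicative.ofAdd 1) ≠ 1 := by
    rw [Ne, map_eq_one_iff _ (ClassifyingStack.quadraticGalEquiv K).injective]
    decide
  obtain ⟨δ, hδ, hσ⟩ := NumberField.exists_sq_eq_discr K hne
  have ha : ¬ IsSquare ((-1 : ℚˣ) : ℚ) := by
    rintro ⟨x, hx⟩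
    rw [Units.val_neg, Units.val_one] at hx
    linarith [mul_self_nonneg x]
  have hd : (NumberField.discr K : ℚ) ≠ 0 := Int.cast_ne_zero.2 (NumberField.discr_ne_zero K)
  rw [ClassifyingStack.specialise_symbol_eq_zero_iff (ClassifyingStack.quadraticPoint K) ha hd
    (b := δ) (hδ.trans (map_intCast (algebraMap ℚ K) _).symm) hσ]
  simp only [Units.val_neg, Units.val_one, neg_one_mul, sub_neg_eq_add]
  constructor
  · rintro ⟨a, b, h⟩
    exact ⟨a, b, by exact_mod_cast h⟩
  · exact Int.exists_eq_sq_add_sq_of_rat
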